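/- **Conventions.** *Machines* are multi-tape Turing machines with a read-only two-way input tape (whose head stays on the input word and its two end markers) and finitely many work tapes, which stop in an accepting state, in a rejecting state, or without an answer. The time used on an input is the number of steps, the space is the number of work tape cells visited, and a bound on either has to hold for all computations on that input. On an input $w$ a machine *answers "yes"* if some computation on $w$ ends in the accepting state, and it *answers "no"* if all computations on $w$ terminate, each of them in the rejecting state. A *complexity class* $\mathcal C$ is given by a mode of computation (deterministic or nondeterministic), by the resources that are controlled (time, space, or both), and, for each controlled resource, by a collection of nondecreasing functions $f:\mathbb N\to\mathbb N$ with $f>0$ such that for every $f$ in the collection and every integer $c\ge 1$ the function $n\mapsto c\,f(cn+c)+c$ is also in the collection. Let $X$ be a finite alphabet, $D\subseteq X^*$ and $S\subseteq X^*$. We say that $D$ is *solvable in $\mathcal C$ on $S$* if there are a machine of the given mode and, for each controlled resource, one function $f$ from its collection, such that (i) on every input $w\in X^*$, each answer "yes" or "no" that the machine gives to the question whether $w\in D$ is correct, and (ii) on every $w\in S$ all computations terminate, the machine gives an answer, and it uses at most $f(|w|)$ of each controlled resource. The problem $D$ is *in $\mathcal C$* if it is solvable in $\mathcal C$ on $X^*$.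 For $S\subseteq X^*$ let $\rho_n(S)$ be the proportion of words in $S$ among all words in $X^*$ of length at most $n$. The set $S$ is *generic* if $\rho_n(S)\to 1$, and *strongly generic* if in addition there are $K>0$ and $0\le\sigma<1$ with $1-\rho_n(S)\le K\sigma^n$ for all $n\ge 1$. The problem $D$ is *generically in $\mathcal C$* (*strongly generically in $\mathcal C$*) if it is solvable in $\mathcal C$ on some generic (strongly generic) set $S$. For a group $G$ and a finite generating tuple $A=(a_1,\dots,a_k)$ of $G$, the word problem $WP(G,A)$ is the set of words over the $2k$ letters $a_1^{\pm1},\dots,a_k^{\pm1}$ that represent $1$ in $G$. The word problem of $G$ is *in $\mathcal C$* (*generically in $\mathcal C$*, *strongly generically in $\mathcal C$*) if $WP(G,A)$ is so for every finite generating tuple $A$ of $G$. **Theorem A.** Let $G$ be a finitely generated group and let $\mathcal C$ be a complexity class. Suppose that some subgroup of finite index in $G$ has an infinite quotient group $\overline G$ whose word problem is in $\mathcal C$. Then the word problem of $G$ is generically in $\mathcal C$. Moreover, if $\overline G$ is non-amenable, then the word problem of $G$ is strongly generically in $\mathcal C$. -/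

import Mathlib

namespace GenericComplexity

/-! ### Multi-tape Turing machines -/

/-- A head movement. -/
inductive Move
  | left
  | stay
  | right

/-- What the input head sees: one of the two end markers or a letter of the input word. -/
inductive InputSymbol (X : Type)
  | leftEnd
  | letter (x : X)
  | rightEnd

/-- The symbol at position `p` of the input tape: position `0` holds the left end marker,
positions `1, …, |w|` hold the letters of `w`, and `|w| + 1` holds the right end marker. -/
def inputAt {X : Type} (w : List X) : ℕ → InputSymbol X
  | 0 => .leftEnd
  | p + 1 =>
    match w[p]? with
    | some x => .letter x
    | none => .rightEnd

/-- Movement of the input head; it never leaves the input word and its two end markers. -/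
def moveInput (n : ℕ) : Move → ℕ → ℕ
  | .left, p => p - 1
  | .stay, p => p
  | .right, p => min (p + 1) (n + 1)

/-- A two-way infinite work tape, of which only the (finite) part visited so far is recorded:
`left` is the part to the left of the head, nearest cell first, and `right` is the part to the
right of the head, nearest cell first. Cells that have not been visited are blank. -/
structure WorkTape (Γ : Type) where
  left : List Γ
  head : Γ
  right : List Γ

namespace WorkTape

/-- The number of cells visited so far. -/
def size {Γ : Type} (T : WorkTape Γ) : ℕ := T.left.length + 1 + T.right.length

/-- Move the head; a newly visited cell is blank. -/
def move {Γ : Type} (blank : Γ) : Move → WorkTape Γ → WorkTape Γ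
  | .stay, T => T
  | .left, ⟨[], a, r⟩ => ⟨[], blank, a :: r⟩
  | .left, ⟨b :: l, a, r⟩ => ⟨l, b, a :: r⟩
  | .right, ⟨l, a, []⟩ => ⟨a :: l, blank, []⟩
  | .right, ⟨l, a, b :: r⟩ => ⟨a :: l, b, r⟩

/-- Write a symbol at the head. -/
def write {Γ : Type} (a : Γ) (T : WorkTape Γ) : WorkTape Γ := { T with head := a }

end WorkTape

/-- A (possibly nondeterministic) multi-tape Turing machine with a read-only two-way input tape
over the alphabet `X` and `numTapes` work tapes. The set `delta q s g` lists the instructions that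
apply in state `q` when the input head sees `s` and the work heads see `g`: a new state, a
movement of the input head and, for each work tape, a symbol to write and a movement. The machine
stops in the states `accept` and `reject`, and also (without an answer) when no instruction
applies. -/
structure Machine (X : Type) where
  State : Type
  finite_state : Finite State
  Sym : Type
  finite_sym : Finite Sym
  blank : Sym
  numTapes : ℕ
  start : State
  accept : State
  reject : State
  accept_ne_reject : accept ≠ reject
  delta : State → InputSymbol X → (Fin numTapes → Sym) →
    Set (State × Move × (Fin numTapes → Sym × Move))

namespace Machine

variable {X : Type}

/-- A configuration: the state, the position of the input head and the work tapes. -/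
structure Config (M : Machine X) where
  state : M.State
  pos : ℕ
  tapes : Fin M.numTapes → WorkTape M.Sym

/-- The number of work tape cells visited up to a configuration, over all work tapes. -/
def Config.space {M : Machine X} (c : M.Config) : ℕ := ∑ i, (c.tapes i).size

/-- The initial configuration: input head on the left end marker, blank work tapes. -/
def init (M : Machine X) : M.Config where
  state := M.start
  pos := 0
  tapes := fun _ => ⟨[], M.blank, []⟩

/-- One step of a computation on the input `w`. -/
def Step (M : Machine X) (w : List X) (c c' : M.Config) : Prop :=
  c.state ≠ M.accept ∧ c.state ≠ M.reject ∧
    ∃ a ∈ M.delta c.state (inputAt w c.pos) (fun i => (c.tapes i).head),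
      c' = { state := a.1
             pos := moveInput w.length a.2.1 c.pos
             tapes := fun i =>
               WorkTape.move M.blank (a.2.2 i).2 ((c.tapes i).write (a.2.2 i).1) }

/-- `M.Reaches w n c`: some computation of `M` on the input `w` is in configuration `c` after
exactly `n` steps. -/
inductive Reaches (M : Machine X) (w : List X) : ℕ → M.Config → Prop
  | init : Reaches M w 0 M.init
  | step {n : ℕ} {c c' : M.Config} : Reaches M w n c → M.Step w c c' → Reaches M w (n + 1) c'

/-- Every computation of `M` on `w` has at most `N` steps. -/
def RunsInTime (M : Machine X) (w : List X) (N : ℕ) : Prop :=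
  ∀ n c, M.Reaches w n c → n ≤ N

/-- Every computation of `M` on `w` visits at most `N` work tape cells. -/
def RunsInSpace (M : Machine X) (w : List X) (N : ℕ) : Prop :=
  ∀ n c, M.Reaches w n c → c.space ≤ N

/-- All computations of `M` on `w` terminate. -/
def Halts (M : Machine X) (w : List X) : Prop := ∃ N, M.RunsInTime w N

/-- `M` answers "yes" on `w`: some computation ends in the accepting state. -/
def Accepts (M : Machine X) (w : List X) : Prop :=
  ∃ n c, M.Reaches w n c ∧ c.state = M.accept

/-- `M` answers "no" on `w`: all computations terminate, each of them in the rejecting state. -/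
def Rejects (M : Machine X) (w : List X) : Prop :=
  M.Halts w ∧ ∀ n c, M.Reaches w n c → (∀ c', ¬ M.Step w c c') → c.state = M.reject

/-- `M` is a correct partial algorithm for `D`: each definite answer that it gives is right. -/
def IsCorrectFor (M : Machine X) (D : Set (List X)) : Prop :=
  ∀ w, (M.Accepts w → w ∈ D) ∧ (M.Rejects w → w ∉ D)

/-- At most one instruction applies in each situation. -/
def IsDeterministic (M : Machine X) : Prop := ∀ q s g, (M.delta q s g).Subsingleton

end Machine

/-! ### Complexity classes -/

/-- The mode of computation. -/
inductive Mode
  | deterministic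
  | nondeterministic

/-- The machine is allowed in the given mode. -/
def Machine.HasMode {X : Type} (M : Machine X) : Mode → Prop
  | .deterministic => M.IsDeterministic
  | .nondeterministic => True

/-- An admissible collection of resource bounds: positive nondecreasing functions, closed under
`f ↦ (n ↦ c * f (c * n + c) + c)` for every integer `c ≥ 1`. (Constructibility of the bounds is
not required, so collections of proper complexity functions are a special case.) -/
def IsBoundFamily (F : Set (ℕ → ℕ)) : Prop :=
  ∀ f ∈ F, Monotone f ∧ (∀ n, 0 < f n) ∧
    ∀ c : ℕ, 1 ≤ c → (fun n => c * f (c * n + c) + c) ∈ F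

/-- The data that determine a complexity class: a mode of computation and, for each of the
resources time and space, either a collection of bounds or `none`, if it is not controlled. -/
structure ComplexityClass where
  mode : Mode
  time : Option (Set (ℕ → ℕ))
  space : Option (Set (ℕ → ℕ))
  time_bounds : ∀ F ∈ time, IsBoundFamily F
  space_bounds : ∀ F ∈ space, IsBoundFamily F

/-- Some correct partial algorithm for `D`, of the right mode, terminates with a definite answer
within the resource bounds of `C` on every input from `S`. -/
def ComplexityClass.SolvesOn (C : ComplexityClass) {X : Type} (D S : Set (List X)) : Prop :=
  ∃ M : Machine X, M.HasMode C.mode ∧ M.IsCorrectFor D ∧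
    (∀ w ∈ S, M.Halts w ∧ (M.Accepts w ∨ M.Rejects w)) ∧
    (∀ F ∈ C.time, ∃ f ∈ F, ∀ w ∈ S, M.RunsInTime w (f w.length)) ∧
    (∀ F ∈ C.space, ∃ f ∈ F, ∀ w ∈ S, M.RunsInSpace w (f w.length))

/-- The decision problem `D` belongs to the class `C`. -/
def ComplexityClass.Contains (C : ComplexityClass) {X : Type} (D : Set (List X)) : Prop :=
  C.SolvesOn D Set.univ

/-! ### Genericity -/

/-- The proportion of words in `S` among all words of length at most `n`. -/
noncomputable def density {X : Type} (S : Set (List X)) (n : ℕ) : ℝ :=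
  ({w : List X | w ∈ S ∧ w.length ≤ n}.ncard : ℝ) / ({w : List X | w.length ≤ n}.ncard : ℝ)

/-- Generic sets of words: the asymptotic density exists and is `1`. -/
def IsGeneric {X : Type} (S : Set (List X)) : Prop :=
  Filter.Tendsto (density S) Filter.atTop (nhds 1)

/-- Strongly generic sets of words: the density tends to `1` exponentially fast. -/
def IsStronglyGeneric {X : Type} (S : Set (List X)) : Prop :=
  IsGeneric S ∧ ∃ σ K : ℝ, 0 ≤ σ ∧ σ < 1 ∧ 0 < K ∧ ∀ n : ℕ, 1 ≤ n → 1 - density S n ≤ K * σ ^ n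

/-- `D` has generic-case complexity `C`. -/
def ComplexityClass.GenericallyContains (C : ComplexityClass) {X : Type}
    (D : Set (List X)) : Prop :=
  ∃ S : Set (List X), IsGeneric S ∧ C.SolvesOn D S

/-- `D` has generic-case complexity strongly `C`. -/
def ComplexityClass.StronglyGenericallyContains (C : ComplexityClass) {X : Type}
    (D : Set (List X)) : Prop :=
  ∃ S : Set (List X), IsStronglyGeneric S ∧ C.SolvesOn D S

/-! ### Word problems -/

/-- The element represented by a word in the generators `π i` and their formal inverses; the
letter `(i, true)` stands for `π i` and `(i, false)` for its inverse. -/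
def evalWord {G : Type*} [Group G] {k : ℕ} (π : Fin k → G) (w : List (Fin k × Bool)) : G :=
  (w.map fun x => if x.2 then π x.1 else (π x.1)⁻¹).prod

/-- `π` is a finite generating tuple of `G`. -/
def Generates {G : Type*} [Group G] {k : ℕ} (π : Fin k → G) : Prop :=
  Subgroup.closure (Set.range π) = ⊤

/-- The word problem of `G` with respect to `π`. -/
def wordProblem {G : Type*} [Group G] {k : ℕ} (π : Fin k → G) : Set (List (Fin k × Bool)) :=
  {w | evalWord π w = 1}

/-- The word problem of `G` is in `C`, for every finite generating tuple. -/
def WordProblemIn (C : ComplexityClass) (G : Type*) [Group G] : Prop :=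
  ∀ (k : ℕ) (π : Fin k → G), Generates π → C.Contains (wordProblem π)

/-- The word problem of `G` is generically in `C`, for every finite generating tuple. -/
def WordProblemGenericallyIn (C : ComplexityClass) (G : Type*) [Group G] : Prop :=
  ∀ (k : ℕ) (π : Fin k → G), Generates π → C.GenericallyContains (wordProblem π)

/-- The word problem of `G` is strongly generically in `C`, for every finite generating tuple. -/
def WordProblemStronglyGenericallyIn (C : ComplexityClass) (G : Type*) [Group G] : Prop :=
  ∀ (k : ℕ) (π : Fin k → G), Generates π → C.StronglyGenericallyContains (wordProblem π)

/-! ### Amenability -/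

/-- A discrete group is amenable if it has a left-invariant finitely additive probability measure
defined on all subsets. -/
def IsAmenable (G : Type*) [Group G] : Prop :=
  ∃ m : Set G → ℝ, (∀ s, 0 ≤ m s) ∧ m Set.univ = 1 ∧
    (∀ s t, Disjoint s t → m (s ∪ t) = m s + m t) ∧
    ∀ (g : G) (s : Set G), m ((fun x => g * x) '' s) = m s

end GenericComplexity

/-! Let φ map the finite-index subgroup G₁ onto Q, and let N be its kernel. Reidemeister–Schreier
rewriting sends a word for 1 in G to a word for 1 in Q. So whenever the algorithm for Q finds the
rewritten word nontrivial, "no" is a correct answer for G; in the other case no answer is given.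
Every letter is replaced by exactly one letter, depending on the current coset of G₁, so a finite
control rewrites while reading. Since the letters permute the cosets, it can also undo a letter when
the head moves left. Hence time and space do not change at all
(`ComplexityClass.Contains.solvesOn_transduce`).

It remains to see that words with trivial rewriting are rare. Such a word moves a base point of G/N
into the finite set of points given by the representatives of the G₁-cosets. As N need not be normal
in G, this concerns a symmetric random walk on the infinite transitive G-set G/N. Its distribution
tends to 0 pointwise by a maximum principle (`tendsto_average_iterate`). If Q is non-amenable, G/N
has no invariant mean (`isAmenable_of_hasInvariantMean`), and Kesten's argument makes averaging a
strict contraction of ℓ², so the decay is exponential (`exists_average_iterate_le`). Bounds on words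
of length n then pass to words of length at most n by summation. -/

namespace GenericComplexity

open Filter Topology

/-! ### Letter-to-letter rewriting by a reversible automaton -/

section Transducer

variable {X Z R : Type}

/-- Rewrite a word letter by letter, where the letter written depends on the letter read and on
the state of an automaton all of whose letters permute the states. -/
def transduce (step : X → Equiv.Perm R) (out : R → X → Z) : R → List X → List Z
  | _, [] => []
  | r, x :: w => out r x :: transduce step out (step x r) w

/-- The state of the automaton after reading a word. -/
def stateAfter (step : X → Equiv.Perm R) (r : R) (w : List X) : R :=
  w.foldl (fun r x => step x r) r

variable (step : X → Equiv.Perm R) (out : R → X → Z)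

@[simp] lemma length_transduce (r : R) (w : List X) :
    (transduce step out r w).length = w.length := by
  induction w generalizing r with
  | nil => rfl
  | cons x w ih => simp [transduce, ih]

lemma getElem?_transduce (r : R) (w : List X) (p : ℕ) :
    (transduce step out r w)[p]? = w[p]?.map (out (stateAfter step r (w.take p))) := by
  induction w generalizing r p with
  | nil => simp [transduce]
  | cons x w ih =>
    cases p with
    | zero => simp [transduce, stateAfter]
    | succ p => simpa [transduce, stateAfter] using ih (step x r) p

lemma stateAfter_take_succ (r : R) {w : List X} {p : ℕ} {x : X} (h : w[p]? = some x) :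
    stateAfter step r (w.take (p + 1)) = step x (stateAfter step r (w.take p)) := by
  rw [List.take_add_one, h]
  simp [stateAfter]

/-- What the rewritten tape shows where the original one shows a given symbol. -/
def InputSymbol.rewrite (r : R) : InputSymbol X → InputSymbol Z
  | .leftEnd => .leftEnd
  | .letter x => .letter (out r x)
  | .rightEnd => .rightEnd

/-- The state of the automaton just before the scanned cell, computed from the state `r` recorded
when the head arrived there; the flag says that the head came from the right. -/
def stateBefore (r : R) : Bool → InputSymbol X → R
  | true, .letter x => (step x).symm r
  | _, _ => r

/-- The recorded state and flag after a movement of the head, from the state of the automaton just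
before the scanned cell. -/
def trackMove (r : R) : InputSymbol X → Move → R × Bool
  | .letter x, .right => (step x r, false)
  | .letter _, .left => (r, true)
  | .rightEnd, .left => (r, true)
  | _, _ => (r, false)

/-- The recorded state and flag agree with the position of the head. -/
def Tracks (r₀ : R) (w : List X) (p : ℕ) (t : R × Bool) : Prop :=
  p ≤ w.length + 1 ∧
    (t.2 = true → p ≤ w.length ∧ t.1 = stateAfter step r₀ (w.take p)) ∧
    (t.2 = false → t.1 = stateAfter step r₀ (w.take (p - 1)))

variable {step}

/-- Reversibility is used here: a head arriving from the right knows the state after the scanned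
letter and inverts that letter's permutation. Cell `p` holds letter number `p - 1`, counted from 0;
truncated subtraction covers the left marker. -/
lemma Tracks.stateBefore_eq {r₀ : R} {w : List X} {p : ℕ} {t : R × Bool}
    (h : Tracks step r₀ w p t) :
    stateBefore step t.1 t.2 (inputAt w p) = stateAfter step r₀ (w.take (p - 1)) := by
  obtain ⟨r, b⟩ := t
  obtain ⟨_, h₁, h₂⟩ := h
  cases b with
  | false => simpa [stateBefore] using h₂ rfl
  | true =>
    obtain ⟨hp, hr⟩ := h₁ rfl
    simp only at hr
    cases p with
    | zero => simpa [inputAt, stateBefore] using hr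
    | succ p =>
      have hx : w[p]? = some (w[p]'(by omega)) := List.getElem?_eq_getElem (by omega)
      rw [stateAfter_take_succ step r₀ hx] at hr
      simp [inputAt, hx, stateBefore, hr]

lemma inputAt_transduce (r₀ : R) (w : List X) (p : ℕ) :
    inputAt (transduce step out r₀ w) p =
      (inputAt w p).rewrite out (stateAfter step r₀ (w.take (p - 1))) := by
  cases p with
  | zero => rfl
  | succ p =>
    simp only [inputAt, getElem?_transduce]
    cases h : w[p]? <;> simp [InputSymbol.rewrite]

lemma Tracks.move {r₀ : R} {w : List X} {p : ℕ} (hp : p ≤ w.length + 1) (m : Move) :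
    Tracks step r₀ w (moveInput w.length m p)
      (trackMove step (stateAfter step r₀ (w.take (p - 1))) (inputAt w p) m) := by
  cases p with
  | zero => cases m <;> simp [Tracks, inputAt, trackMove, moveInput]
  | succ p =>
    cases h : w[p]? with
    | none =>
      have hl : w.length ≤ p := by simpa using h
      obtain rfl : p = w.length := by omega
      cases m <;> simp [Tracks, inputAt, trackMove, moveInput]
    | some x =>
      have hl : p < w.length := by
        by_contra hc
        rw [List.getElem?_eq_none (by omega)] at h
        simp at h
      cases m with
      | left => simp [Tracks, inputAt, h, trackMove, moveInput]; omega
      | stay => simp [Tracks, inputAt, h, trackMove, moveInput]; omega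
      | right =>
        have hm : min (p + 1 + 1) (w.length + 1) = p + 2 := by omega
        simp only [Tracks, inputAt, h, trackMove, moveInput, hm]
        refine ⟨by omega, by simp, fun _ => ?_⟩
        simpa using (stateAfter_take_succ step r₀ h).symm

end Transducer

/-! ### Running a machine on a rewritten word -/

namespace Machine

variable {X Z R : Type} (M : Machine Z) (step : X → Equiv.Perm R) (out : R → X → Z) (r₀ : R)

open Classical in
/-- A state of `M` with the recorded state of the automaton; all of them are merged into one
state when `M` rejects. -/
noncomputable def tagState (q : M.State) (t : R × Bool) : Bool ⊕ (M.State × (R × Bool)) :=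
  -- A machine has a single rejecting state, so the tag must be forgotten there. The value `.inl
  -- true` never occurs and serves as an unreachable accepting state.
  if q = M.reject then .inl false else .inr (q, t)

lemma tagState_of_ne {M : Machine Z} {q : M.State} (h : q ≠ M.reject) (t : R × Bool) :
    M.tagState q t = .inr (q, t) := by simp [tagState, h]

/-- The machine that runs `M` on the rewritten input without writing that down, and that stops
without an answer where `M` accepts. -/
noncomputable def pullback [Finite R] : Machine X where
  State := Bool ⊕ (M.State × (R × Bool))
  finite_state := by
    have := M.finite_state
    infer_instance
  Sym := M.Sym
  finite_sym := M.finite_sym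
  blank := M.blank
  numTapes := M.numTapes
  start := M.tagState M.start (r₀, false)
  accept := .inl true
  reject := .inl false
  accept_ne_reject := by simp
  delta := fun q s g =>
    match q with
    | .inl _ => ∅
    -- `M` stops in its accepting state whatever `M.delta` lists there; here that state is not
    -- terminal by decree, so its instructions have to be removed.
    | .inr (q, t) => {a' | q ≠ M.accept ∧
        ∃ a ∈ M.delta q (s.rewrite out (stateBefore step t.1 t.2 s)) g,
          a' = (M.tagState a.1 (trackMove step (stateBefore step t.1 t.2 s) s a.2.1), a.2)}

variable [Finite R]

lemma isDeterministic_pullback (h : M.IsDeterministic) :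
    (M.pullback step out r₀).IsDeterministic := by
  rintro (q | ⟨q, t⟩) s g
  · exact Set.subsingleton_empty
  · rintro _ ⟨_, a, ha, rfl⟩ _ ⟨_, b, hb, rfl⟩
    rw [h _ _ _ ha hb]

lemma hasMode_pullback {m : Mode} (h : M.HasMode m) : (M.pullback step out r₀).HasMode m := by
  cases m with
  | deterministic => exact M.isDeterministic_pullback step out r₀ h
  | nondeterministic => trivial

variable {M step out r₀}

/-- The configuration `c'` of the pulled back machine stands for the configuration `c`. -/
def Simulates (w : List X) (c' : (M.pullback step out r₀).Config) (c : M.Config) : Prop :=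
  ∃ t : R × Bool, c'.state = M.tagState c.state t ∧ Tracks step r₀ w c.pos t ∧
    c'.pos = c.pos ∧ c'.tapes = c.tapes

lemma simulates_init (w : List X) :
    Simulates w (M.pullback step out r₀).init M.init :=
  ⟨(r₀, false), rfl, by simp [Tracks, init, stateAfter], rfl, rfl⟩

lemma Simulates.state_eq_reject_iff {w : List X} {c' : (M.pullback step out r₀).Config}
    {c : M.Config} (h : Simulates w c' c) :
    c'.state = (M.pullback step out r₀).reject ↔ c.state = M.reject := by
  obtain ⟨t, hs, -⟩ := h
  rw [hs]
  by_cases hr : c.state = M.reject <;> simp [tagState, hr, pullback]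

lemma Simulates.state_ne_accept {w : List X} {c' : (M.pullback step out r₀).Config}
    {c : M.Config} (h : Simulates w c' c) : c'.state ≠ (M.pullback step out r₀).accept := by
  obtain ⟨t, hs, -⟩ := h
  rw [hs]
  by_cases hr : c.state = M.reject <;> simp [tagState, hr, pullback]

lemma Simulates.space_eq {w : List X} {c' : (M.pullback step out r₀).Config}
    {c : M.Config} (h : Simulates w c' c) : c'.space = c.space := by
  obtain ⟨t, -, -, -, ht⟩ := h
  unfold Config.space
  rw [ht]
  rfl

lemma Simulates.step_forward {w : List X} {c' d' : (M.pullback step out r₀).Config}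
    {c : M.Config} (h : Simulates w c' c) (hd : (M.pullback step out r₀).Step w c' d') :
    ∃ d, M.Step (transduce step out r₀ w) c d ∧ Simulates w d' d := by
  have hrej : c.state ≠ M.reject := fun e => hd.2.1 (h.state_eq_reject_iff.2 e)
  obtain ⟨q', p', T'⟩ := c'
  obtain ⟨t, hs, htr, hp, hT⟩ := h
  simp only at hs hp hT
  subst hs hp hT
  obtain ⟨-, -, a', ha', rfl⟩ := hd
  simp only [tagState_of_ne hrej] at ha'
  obtain ⟨hacc, a, ha, rfl⟩ := ha'
  rw [htr.stateBefore_eq, ← inputAt_transduce] at ha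
  refine ⟨_, ⟨hacc, hrej, a, ha, rfl⟩, _, rfl, ?_, ?_, rfl⟩
  · rw [htr.stateBefore_eq, length_transduce]
    exact Tracks.move htr.1 _
  · simp

/-- Answering "no" quantifies over all halted computations, so a halted simulating configuration
must come from a halted one of `M`; this needs the simulation in both directions. -/
lemma Simulates.step_backward {w : List X} {c' : (M.pullback step out r₀).Config}
    {c d : M.Config} (h : Simulates w c' c) (hd : M.Step (transduce step out r₀ w) c d) :
    ∃ d', (M.pullback step out r₀).Step w c' d' ∧ Simulates w d' d := by
  have hacc' := h.state_ne_accept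
  have hrej' : c'.state ≠ (M.pullback step out r₀).reject :=
    fun e => hd.2.1 (h.state_eq_reject_iff.1 e)
  obtain ⟨q', p', T'⟩ := c'
  obtain ⟨t, hs, htr, hp, hT⟩ := h
  simp only at hs hp hT
  subst hs hp hT
  obtain ⟨hacc, hrej, a, ha, rfl⟩ := hd
  refine ⟨_, ⟨hacc', hrej',
    (M.tagState a.1 (trackMove step (stateBefore step t.1 t.2 (inputAt w c.pos))
      (inputAt w c.pos) a.2.1), a.2), ?_, rfl⟩, _, rfl, ?_, ?_, rfl⟩
  · simp only [tagState_of_ne hrej]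
    refine ⟨hacc, a, ?_, rfl⟩
    rw [htr.stateBefore_eq, ← inputAt_transduce]
    exact ha
  · rw [htr.stateBefore_eq, length_transduce]
    exact Tracks.move htr.1 _
  · simp

lemma exists_reaches_of_pullback {w : List X} {n : ℕ} {c' : (M.pullback step out r₀).Config}
    (h : (M.pullback step out r₀).Reaches w n c') :
    ∃ c, M.Reaches (transduce step out r₀ w) n c ∧ Simulates w c' c := by
  induction h with
  | init => exact ⟨_, .init, simulates_init w⟩
  | step _ hs ih =>
    obtain ⟨c, hc, hsim⟩ := ih
    obtain ⟨d, hd, hsim'⟩ := hsim.step_forward hs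
    exact ⟨d, .step hc hd, hsim'⟩

lemma exists_pullback_reaches {w : List X} {n : ℕ} {c : M.Config}
    (h : M.Reaches (transduce step out r₀ w) n c) :
    ∃ c', (M.pullback step out r₀).Reaches w n c' ∧ Simulates w c' c := by
  induction h with
  | init => exact ⟨_, .init, simulates_init w⟩
  | step _ hs ih =>
    obtain ⟨c', hc, hsim⟩ := ih
    obtain ⟨d, hd, hsim'⟩ := hsim.step_backward hs
    exact ⟨d, .step hc hd, hsim'⟩

lemma not_accepts_pullback (w : List X) : ¬ (M.pullback step out r₀).Accepts w := by
  rintro ⟨n, c', hc, hacc⟩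
  obtain ⟨c, -, hsim⟩ := exists_reaches_of_pullback hc
  exact hsim.state_ne_accept hacc

lemma RunsInTime.pullback {w : List X} {N : ℕ}
    (h : M.RunsInTime (transduce step out r₀ w) N) :
    (M.pullback step out r₀).RunsInTime w N := by
  intro n c' hc
  obtain ⟨c, hc, -⟩ := exists_reaches_of_pullback hc
  exact h n c hc

lemma RunsInSpace.pullback {w : List X} {N : ℕ}
    (h : M.RunsInSpace (transduce step out r₀ w) N) :
    (M.pullback step out r₀).RunsInSpace w N := by
  intro n c' hc
  obtain ⟨c, hc, hsim⟩ := exists_reaches_of_pullback hc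
  exact hsim.space_eq ▸ h n c hc

lemma Rejects.pullback {w : List X} (h : M.Rejects (transduce step out r₀ w)) :
    (M.pullback step out r₀).Rejects w := by
  obtain ⟨⟨N, hN⟩, hrej⟩ := h
  refine ⟨⟨N, hN.pullback⟩, fun n c' hc hhalted => ?_⟩
  obtain ⟨c, hc, hsim⟩ := exists_reaches_of_pullback hc
  refine hsim.state_eq_reject_iff.2 (hrej n c hc fun d hd => ?_)
  obtain ⟨d', hd', -⟩ := hsim.step_backward hd
  exact hhalted d' hd'

/-- An accepting computation of `M` becomes one that is stuck outside the rejecting state. This one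
computation prevents "no", whatever the other nondeterministic branches do. -/
lemma not_rejects_pullback {w : List X} (h : M.Accepts (transduce step out r₀ w)) :
    ¬ (M.pullback step out r₀).Rejects w := by
  rintro ⟨-, hrej⟩
  obtain ⟨n, c, hc, hacc⟩ := h
  obtain ⟨c', hc', hsim⟩ := exists_pullback_reaches hc
  refine M.accept_ne_reject (hacc.symm.trans (hsim.state_eq_reject_iff.1 (hrej n c' hc' ?_)))
  intro d' hd'
  obtain ⟨d, hd, -⟩ := hsim.step_forward hd'
  exact hd.1 hacc

end Machine

/-- If `E` is in the class `C`, then a problem all of whose elements are rewritten to elements of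
`E` is solved in `C` on the words that are not rewritten to elements of `E`. -/
lemma ComplexityClass.Contains.solvesOn_transduce {C : ComplexityClass} {X Z R : Type} [Finite R]
    {E : Set (List Z)} (hE : C.Contains E) (step : X → Equiv.Perm R) (out : R → X → Z) (r₀ : R)
    {D : Set (List X)} (hD : ∀ w ∈ D, transduce step out r₀ w ∈ E) :
    C.SolvesOn D {w | transduce step out r₀ w ∉ E} := by
  obtain ⟨M, hmode, hcorr, hans, htime, hspace⟩ := hE
  refine ⟨M.pullback step out r₀, M.hasMode_pullback step out r₀ hmode, fun w => ⟨?_, ?_⟩,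
    fun w hw => ?_, fun F hF => ?_, fun F hF => ?_⟩
  · exact fun h => absurd h (Machine.not_accepts_pullback w)
  · intro hrej hw
    -- Correctness is required on all inputs; it holds because `M` answers on every word.
    rcases (hans (transduce step out r₀ w) trivial).2 with h | h
    · exact Machine.not_rejects_pullback h hrej
    · exact (hcorr _).2 h (hD w hw)
  · have hr : M.Rejects (transduce step out r₀ w) :=
      (hans _ trivial).2.resolve_left fun h => hw ((hcorr _).1 h)
    exact ⟨hr.pullback.1, .inr hr.pullback⟩
  · obtain ⟨f, hf, hle⟩ := htime F hF
    refine ⟨f, hf, fun w _ => ?_⟩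
    -- Rewriting preserves length, so the bound `f` itself serves.
    simpa using (hle (transduce step out r₀ w) trivial).pullback
  · obtain ⟨f, hf, hle⟩ := hspace F hF
    refine ⟨f, hf, fun w _ => ?_⟩
    simpa using (hle (transduce step out r₀ w) trivial).pullback

/-! ### Words of a given length -/

/-- The words of length `n`. -/
def wordsOfLength (X : Type*) [Fintype X] : ℕ → Finset (List X)
  | 0 => {[]}
  | n + 1 => (Finset.univ ×ˢ wordsOfLength X n).map
      ⟨fun p => p.1 :: p.2, fun p q h => by simpa [Prod.ext_iff] using h⟩

section Words

variable {X : Type*} [Fintype X]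

@[simp] lemma mem_wordsOfLength {n : ℕ} {w : List X} : w ∈ wordsOfLength X n ↔ w.length = n := by
  induction n generalizing w with
  | zero => simp [wordsOfLength]
  | succ n ih =>
    rw [wordsOfLength, Finset.mem_map]
    cases w with
    | nil => simp
    | cons x w =>
      refine ⟨?_, fun h => ⟨(x, w), by simpa [ih] using h, rfl⟩⟩
      rintro ⟨⟨y, v⟩, hv, hvw⟩
      obtain ⟨rfl, rfl⟩ : y = x ∧ v = w := by simpa using List.cons.inj hvw
      simpa [ih] using hv

lemma sum_wordsOfLength_succ {M : Type*} [AddCommMonoid M] (n : ℕ) (F : List X → M) :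
    ∑ w ∈ wordsOfLength X (n + 1), F w = ∑ x, ∑ w ∈ wordsOfLength X n, F (x :: w) := by
  rw [wordsOfLength, Finset.sum_map, Finset.sum_product]
  rfl

lemma card_wordsOfLength (n : ℕ) : (wordsOfLength X n).card = Fintype.card X ^ n := by
  induction n with
  | zero => simp [wordsOfLength]
  | succ n ih => simp [wordsOfLength, ih, pow_succ']

end Words

/-! ### Random walks on a set with a group action -/

section Walk

variable {X G Y : Type*} [Fintype X] [Group G] [MulAction G Y]

/-- The average of a function over the translates by the elements `a x`. -/
noncomputable def average (a : X → G) (f : Y → ℝ) (y : Y) : ℝ :=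
  (∑ x, f ((a x)⁻¹ • y)) / Fintype.card X

variable {a : X → G} {f : Y → ℝ} {B : ℝ}

lemma average_iterate (n : ℕ) (y : Y) :
    (average a)^[n] f y =
      (∑ w ∈ wordsOfLength X n, f ((w.map a).prod⁻¹ • y)) / (Fintype.card X : ℝ) ^ n := by
  induction n generalizing y with
  | zero => simp [wordsOfLength]
  | succ n ih =>
    rw [Function.iterate_succ_apply', average]
    simp_rw [ih, sum_wordsOfLength_succ, ← Finset.sum_div, div_div, ← pow_succ]
    simp [mul_smul]

lemma average_iterate_nonneg (hf : ∀ y, 0 ≤ f y) (n : ℕ) (y : Y) : 0 ≤ (average a)^[n] f y := by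
  rw [average_iterate]
  exact div_nonneg (Finset.sum_nonneg fun w _ => hf _) (by positivity)

/-- Translations permute `Y`, so each translate obeys the same bound on finite sums. -/
lemma sum_average_le [Nonempty X] (hf : ∀ A : Finset Y, ∑ y ∈ A, f y ≤ B) (A : Finset Y) :
    ∑ y ∈ A, average a f y ≤ B := by
  have hd : (0 : ℝ) < Fintype.card X := by exact_mod_cast Fintype.card_pos
  unfold average
  rw [← Finset.sum_div, Finset.sum_comm, div_le_iff₀ hd]
  calc ∑ x, ∑ y ∈ A, f ((a x)⁻¹ • y) ≤ ∑ _x : X, B := by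
        refine Finset.sum_le_sum fun x _ => ?_
        simpa using hf (A.map (MulAction.toPerm (a x)⁻¹).toEmbedding)
    _ = B * Fintype.card X := by simp [mul_comm]

lemma sum_average_iterate_le [Nonempty X] (hf : ∀ A : Finset Y, ∑ y ∈ A, f y ≤ B) (n : ℕ)
    (A : Finset Y) : ∑ y ∈ A, (average a)^[n] f y ≤ B := by
  induction n generalizing A with
  | zero => exact hf A
  | succ n ih =>
    simp_rw [Function.iterate_succ_apply']
    exact sum_average_le ih A

open Classical in
/-- The points that the walk can reach from `z` in exactly `n` steps. -/
noncomputable def reachable (a : X → G) (n : ℕ) (z : Y) : Finset Y :=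
  (wordsOfLength X n).image fun w => (w.map a).prod⁻¹ • z

lemma mem_reachable {n : ℕ} {y z : Y} :
    y ∈ reachable a n z ↔ ∃ w : List X, w.length = n ∧ (w.map a).prod⁻¹ • z = y := by
  simp [reachable]

lemma inv_smul_mem_reachable {n : ℕ} {y z : Y} (h : y ∈ reachable a n z) (x : X) :
    (a x)⁻¹ • y ∈ reachable a (n + 1) z := by
  obtain ⟨w, rfl, rfl⟩ := mem_reachable.1 h
  exact mem_reachable.2 ⟨w ++ [x], by simp, by simp [mul_smul]⟩

/-- Otherwise the points reachable in `n` or `n + 1` steps would form a nonempty finite invariant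
set, against transitivity on an infinite set. -/
lemma not_reachable_stable [Infinite Y] [MulAction.IsPretransitive G Y]
    (hgen : ∀ g : G, ∃ w : List X, (w.map a).prod = g) (n : ℕ) (z : Y)
    (hne : (reachable a n z).Nonempty) : reachable a (n + 2) z ≠ reachable a n z := by
  classical
  intro he
  obtain ⟨y₀, hy₀⟩ := hne
  set U : Finset Y := reachable a n z ∪ reachable a (n + 1) z with hU
  have hstep : ∀ x, ∀ y ∈ U, (a x)⁻¹ • y ∈ U := by
    intro x y hy
    rcases Finset.mem_union.1 hy with h | h
    · exact Finset.mem_union_right _ (inv_smul_mem_reachable h x)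
    · exact Finset.mem_union_left _ (he ▸ inv_smul_mem_reachable h x)
  have hword : ∀ w : List X, ∀ y ∈ U, (w.map a).prod⁻¹ • y ∈ U := by
    intro w
    induction w with
    | nil => simp
    | cons x w ih =>
      intro y hy
      simpa [mul_smul] using ih _ (hstep x y hy)
  refine Infinite.exists_notMem_finset U |>.elim fun y hy => hy ?_
  obtain ⟨g, rfl⟩ := MulAction.exists_smul_eq G y₀ y
  obtain ⟨w, hw⟩ := hgen g⁻¹
  simpa [hw] using hword w y₀ (Finset.mem_union_left _ hy₀)

/-- Only even times are compared: stepping forth and back makes the sets increase by steps of two,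
while a bipartite walk has no inclusion between consecutive times. -/
lemma succ_le_card_reachable [Nonempty X] [Infinite Y] [MulAction.IsPretransitive G Y]
    (hinv : ∀ x, ∃ x', a x' = (a x)⁻¹)
    (hgen : ∀ g : G, ∃ w : List X, (w.map a).prod = g) (r : ℕ) (z : Y) :
    r + 1 ≤ (reachable a (2 * r) z).card := by
  induction r with
  | zero =>
    exact Finset.card_pos.2 ⟨z, mem_reachable.2 ⟨[], by simp⟩⟩
  | succ r ih =>
    have hne : (reachable a (2 * r) z).Nonempty := Finset.card_pos.1 (by omega)
    have hsub : reachable a (2 * r) z ⊆ reachable a (2 * r + 2) z := by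
      intro y hy
      obtain ⟨x'⟩ := ‹Nonempty X›
      obtain ⟨x, hx⟩ := hinv x'
      have := inv_smul_mem_reachable (inv_smul_mem_reachable hy x') x
      simpa [hx] using this
    have := Finset.card_lt_card
      (hsub.ssubset_of_ne (not_reachable_stable hgen (2 * r) z hne).symm)
    rw [show 2 * (r + 1) = 2 * r + 2 by ring]
    omega

/-- On an infinite set with a transitive action, the distribution of a symmetric random walk tends
to zero pointwise. -/
lemma tendsto_average_iterate [Nonempty X] [Infinite Y] [MulAction.IsPretransitive G Y]
    (hinv : ∀ x, ∃ x', a x' = (a x)⁻¹)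
    (hgen : ∀ g : G, ∃ w : List X, (w.map a).prod = g)
    (hf : ∀ y, 0 ≤ f y) (hf₁ : ∀ A : Finset Y, ∑ y ∈ A, f y ≤ B) (z : Y) :
    Tendsto (fun n => (average a)^[n] f z) atTop (𝓝 0) := by
  set u : ℕ → Y → ℝ := fun n => (average a)^[n] f with hu
  have hu0 : ∀ n y, 0 ≤ u n y := average_iterate_nonneg hf
  have hu1 : ∀ n (A : Finset Y), ∑ y ∈ A, u n y ≤ B := sum_average_iterate_le hf₁
  have hd : (0 : ℝ) < Fintype.card X := by exact_mod_cast Fintype.card_pos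
  have hne : Nonempty Y := ⟨z⟩
  have hbdd : ∀ n, BddAbove (Set.range (u n)) := fun n =>
    ⟨B, by rintro _ ⟨y, rfl⟩; simpa using hu1 n {y}⟩
  set S : ℕ → ℝ := fun n => ⨆ y, u n y with hS
  have hle : ∀ n y, u n y ≤ S n := fun n y => le_ciSup (hbdd n) y
  have hanti : Antitone S := by
    refine antitone_nat_of_succ_le fun n => ciSup_le fun y => ?_
    simp only [hu, Function.iterate_succ_apply']
    rw [average, div_le_iff₀ hd]
    calc ∑ x, u n ((a x)⁻¹ • y) ≤ ∑ _x : X, S n := Finset.sum_le_sum fun x _ => hle n _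
      _ = S n * Fintype.card X := by simp [mul_comm]
  have hS0 : ∀ n, 0 ≤ S n := fun n => (hu0 n z).trans (hle n z)
  have hSbdd : BddBelow (Set.range S) := ⟨0, by rintro _ ⟨n, rfl⟩; exact hS0 n⟩
  have hlim := tendsto_atTop_ciInf hanti hSbdd
  set L : ℝ := ⨅ n, S n with hL
  have hLle : ∀ n, L ≤ S n := fun n => ciInf_le hSbdd n
  have hL0 : 0 ≤ L := le_ciInf hS0
  suffices hLz : L = 0 from
    squeeze_zero (fun n => hu0 n z) (fun n => hle n z) (hLz ▸ hlim)
  by_contra hLne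
  have hLpos : 0 < L := lt_of_le_of_ne hL0 (Ne.symm hLne)
  -- With this `r`, any `r + 1` points of value at least `L / 2` carry total mass above `B`.
  obtain ⟨r, hr⟩ := exists_nat_gt (2 * B / L)
  set D : ℝ := (Fintype.card X : ℝ) ^ (2 * r) with hD
  have hDpos : 0 < D := by positivity
  obtain ⟨ε, hε, hεD⟩ : ∃ ε : ℝ, 0 < ε ∧ 2 * D * ε ≤ L / 2 :=
    ⟨L / (4 * D), by positivity, by field_simp; norm_num⟩
  obtain ⟨n, hn⟩ := (hlim.eventually (gt_mem_nhds (show L < L + ε by linarith))).exists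
  obtain ⟨y, hy⟩ := exists_lt_of_lt_ciSup
    (show L - ε < S (2 * r + n) by linarith [hLle (2 * r + n)])
  -- The value at `y` exceeds `L - ε` and is an average of `D` values, none above `S n < L + ε`. The
  -- deficits from `S n` are nonnegative with sum at most `2 * D * ε ≤ L / 2`, so each single
  -- deficit is at most `L / 2`.
  have hpoint : ∀ b ∈ reachable a (2 * r) y, L / 2 ≤ u n b := by
    intro b hb
    obtain ⟨v, hv, rfl⟩ := mem_reachable.1 hb
    have hmem : v ∈ wordsOfLength X (2 * r) := by simpa using hv
    have hsum : u (2 * r + n) y * D =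
        ∑ w ∈ wordsOfLength X (2 * r), u n ((w.map a).prod⁻¹ • y) := by
      simp only [hu]
      rw [Function.iterate_add_apply, average_iterate, div_mul_cancel₀ _ hDpos.ne']
    have hcard : ((wordsOfLength X (2 * r)).card : ℝ) = D := by
      rw [card_wordsOfLength]; push_cast; rfl
    have hbound : ∑ w ∈ wordsOfLength X (2 * r), (S n - u n ((w.map a).prod⁻¹ • y)) ≥
        S n - u n ((v.map a).prod⁻¹ • y) :=
      Finset.single_le_sum (f := fun w => S n - u n ((w.map a).prod⁻¹ • y))
        (fun w _ => sub_nonneg.2 (hle n _)) hmem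
    rw [Finset.sum_sub_distrib, ← hsum, Finset.sum_const, nsmul_eq_mul, hcard] at hbound
    have h1 : (L - ε) * D ≤ u (2 * r + n) y * D := by gcongr
    have h2 : D * S n ≤ D * (L + ε) := by gcongr
    nlinarith [hLle n]
  have hsum := Finset.card_nsmul_le_sum _ _ _ hpoint
  rw [nsmul_eq_mul] at hsum
  have hcard : ((r : ℝ) + 1) ≤ (reachable a (2 * r) y).card := by
    exact_mod_cast succ_le_card_reachable hinv hgen r y
  rw [div_lt_iff₀ hLpos] at hr
  have := hu1 n (reachable a (2 * r) y)
  nlinarith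

end Walk

/-! ### Invariant means and the spectral radius of a random walk -/

section Mean

variable {X G Y : Type*} [Group G] [MulAction G Y]

/-- The action of `G` on `Y` has an invariant finitely additive probability measure. -/
def HasInvariantMean (G Y : Type*) [Group G] [MulAction G Y] : Prop :=
  ∃ m : Set Y → ℝ, (∀ s, 0 ≤ m s) ∧ m Set.univ = 1 ∧
    (∀ s t, Disjoint s t → m (s ∪ t) = m s + m t) ∧
    ∀ (g : G) (s : Set Y), m ((fun y => g • y) ⁻¹' s) = m s

/-- A mean that is invariant under all quotients of two letters gives rise to one that is
invariant under the group. -/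
lemma hasInvariantMean_of_letters [Nonempty X] {a : X → G}
    (hinv : ∀ x, ∃ x', a x' = (a x)⁻¹)
    (hgen : ∀ g : G, ∃ w : List X, (w.map a).prod = g) {m : Set Y → ℝ}
    (h0 : ∀ s, 0 ≤ m s) (h1 : m Set.univ = 1)
    (hadd : ∀ s t, Disjoint s t → m (s ∪ t) = m s + m t)
    (hm : ∀ x x' s, m ((fun y => a x • y) ⁻¹' s) = m ((fun y => a x' • y) ⁻¹' s)) :
    HasInvariantMean G Y := by
  obtain ⟨x₀⟩ := ‹Nonempty X›
  -- All letters move `m` to the same mean, and a second letter moves it back because inverses are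
  -- letters. Every letter thus swaps the two means averaged here.
  refine ⟨fun s => (m s + m ((fun y => a x₀ • y) ⁻¹' s)) / 2,
    fun s => by linarith [h0 s, h0 ((fun y => a x₀ • y) ⁻¹' s)], by simp [h1], fun s t hst => ?_,
    fun g s => ?_⟩
  · simp only
    rw [Set.preimage_union, hadd s t hst, hadd _ _ (hst.preimage _)]
    ring
  · obtain ⟨w, rfl⟩ := hgen g
    induction w generalizing s with
    | nil => simp
    | cons x w ih =>
      have hcomp : (fun y : Y => ((x :: w).map a).prod • y) ⁻¹' s =
          (fun y => (w.map a).prod • y) ⁻¹' ((fun y => a x • y) ⁻¹' s) := by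
        ext y
        simp [mul_smul]
      rw [hcomp, ih]
      obtain ⟨x', hx'⟩ := hinv x
      have h2 : m ((fun y => a x₀ • y) ⁻¹' ((fun y => a x • y) ⁻¹' s)) = m s := by
        rw [hm x₀ x', hx']
        congr 1
        ext y
        simp
      simp only
      rw [h2, hm x x₀, add_comm]

variable [Fintype X]

/-- The square of the `ℓ²`-norm. -/
noncomputable def sqSum (f : Y → ℝ) : ℝ := ∑' y, f y ^ 2

lemma sqSum_nonneg {Y : Type*} (f : Y → ℝ) : 0 ≤ sqSum f := tsum_nonneg fun _ => sq_nonneg _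

lemma sqSum_smul (f : Y → ℝ) (g : G) : sqSum (fun y => f (g • y)) = sqSum f :=
  (MulAction.toPerm g).tsum_eq fun y => f y ^ 2

lemma finite_support_smul {f : Y → ℝ} (hf : f.support.Finite) (g : G) :
    (Function.support fun y => f (g • y)).Finite :=
  hf.preimage (f := fun y => g • y) (MulAction.injective g).injOn

lemma finite_support_average {f : Y → ℝ} (hf : f.support.Finite) (a : X → G) :
    (average a f).support.Finite := by
  refine (Set.finite_iUnion fun x => finite_support_smul hf (a x)⁻¹).subset fun y hy => ?_
  by_contra hc
  simp only [Set.mem_iUnion, Function.mem_support, not_exists, not_not] at hc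
  exact hy (by simp [average, hc])

lemma summable_of_support_subset {Y : Type*} {f F : Y → ℝ} (hf : f.support.Finite)
    (h : ∀ y, f y = 0 → F y = 0) : Summable F :=
  summable_of_hasFiniteSupport (hf.subset fun y hy hfy => hy (h y hfy))

lemma sq_le_sqSum {Y : Type*} {f : Y → ℝ} (hf : f.support.Finite) (z : Y) : f z ^ 2 ≤ sqSum f :=
  (summable_of_support_subset hf fun y hy => by simp [hy]).le_tsum z fun _ _ => sq_nonneg _

lemma sum_sum_sub_sq (b : X → ℝ) :
    ∑ x, ∑ x', (b x - b x') ^ 2 =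
      2 * (Fintype.card X * ∑ x, b x ^ 2) - 2 * (∑ x, b x) ^ 2 := by
  have h : ∀ x x', (b x - b x') ^ 2 = b x ^ 2 + b x' ^ 2 - 2 * (b x * b x') := fun _ _ => by ring
  simp_rw [h, Finset.sum_sub_distrib, Finset.sum_add_distrib, ← Finset.mul_sum, ← Finset.sum_mul]
  simp only [Finset.sum_const, Finset.card_univ, nsmul_eq_mul, ← Finset.mul_sum]
  ring

lemma summable_sub_sq {f : Y → ℝ} (hf : f.support.Finite) (g h : G) :
    Summable fun y => (f (g • y) - f (h • y)) ^ 2 := by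
  refine summable_of_hasFiniteSupport
    (((finite_support_smul hf g).union (finite_support_smul hf h)).subset fun y hy => ?_)
  by_contra hc
  simp only [Set.mem_union, Function.mem_support, not_or, not_not] at hc
  exact hy (by simp [hc.1, hc.2])

/-- The loss of norm under averaging measures how far the translates are apart. -/
lemma sum_sum_sqSum_sub [Nonempty X] {f : Y → ℝ} (hf : f.support.Finite) (a : X → G) :
    ∑ x, ∑ x', sqSum (fun y => f ((a x)⁻¹ • y) - f ((a x')⁻¹ • y)) =
      2 * (Fintype.card X : ℝ) ^ 2 * (sqSum f - sqSum (average a f)) := by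
  have hd : (Fintype.card X : ℝ) ≠ 0 := by exact_mod_cast Fintype.card_ne_zero
  have hs : ∀ x, Summable fun y => f ((a x)⁻¹ • y) ^ 2 := fun x =>
    summable_of_support_subset (finite_support_smul hf (a x)⁻¹) fun y hy => by simp [hy]
  have hsa : Summable fun y => average a f y ^ 2 :=
    summable_of_support_subset (finite_support_average hf a) fun y hy => by simp [hy]
  have hpt : ∀ y, ∑ x, ∑ x', (f ((a x)⁻¹ • y) - f ((a x')⁻¹ • y)) ^ 2 =
      2 * Fintype.card X * ∑ x, f ((a x)⁻¹ • y) ^ 2 -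
        2 * (Fintype.card X : ℝ) ^ 2 * average a f y ^ 2 := by
    intro y
    rw [sum_sum_sub_sq fun x => f ((a x)⁻¹ • y), average]
    field_simp
  calc ∑ x, ∑ x', sqSum (fun y => f ((a x)⁻¹ • y) - f ((a x')⁻¹ • y))
      = ∑' y, ∑ x, ∑ x', (f ((a x)⁻¹ • y) - f ((a x')⁻¹ • y)) ^ 2 := by
        rw [Summable.tsum_finsetSum fun x _ => summable_sum fun x' _ => summable_sub_sq hf _ _]
        refine Finset.sum_congr rfl fun x _ => ?_
        rw [Summable.tsum_finsetSum fun x' _ => summable_sub_sq hf _ _]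
        rfl
    _ = 2 * Fintype.card X * ∑' y, ∑ x, f ((a x)⁻¹ • y) ^ 2 -
          2 * (Fintype.card X : ℝ) ^ 2 * sqSum (average a f) := by
        simp_rw [hpt]
        rw [Summable.tsum_sub ((summable_sum fun x _ => hs x).mul_left _) (hsa.mul_left _),
          tsum_mul_left, tsum_mul_left]
        rfl
    _ = _ := by
        rw [Summable.tsum_finsetSum fun x _ => hs x]
        have : ∀ x, ∑' y, f ((a x)⁻¹ • y) ^ 2 = sqSum f := fun x => sqSum_smul f _
        simp_rw [this]
        simp only [Finset.sum_const, Finset.card_univ, nsmul_eq_mul]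
        ring

/-- The mass that the density `f ^ 2` gives to a set. -/
noncomputable def sqMass {Y : Type*} (f : Y → ℝ) (s : Set Y) : ℝ :=
  ∑' y, s.indicator (fun y => f y ^ 2) y

lemma summable_sqMass {Y : Type*} {f : Y → ℝ} (hf : f.support.Finite) (s : Set Y) :
    Summable (s.indicator fun y => f y ^ 2) :=
  summable_of_support_subset hf fun y hy => by simp [Set.indicator, hy]

lemma sqMass_nonneg {Y : Type*} (f : Y → ℝ) (s : Set Y) : 0 ≤ sqMass f s :=
  tsum_nonneg fun _ => Set.indicator_nonneg (fun _ _ => sq_nonneg _) _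

lemma sqMass_le_sqSum {Y : Type*} {f : Y → ℝ} (hf : f.support.Finite) (s : Set Y) :
    sqMass f s ≤ sqSum f :=
  (summable_sqMass hf s).tsum_le_tsum
    (fun _ => Set.indicator_le_self' (fun _ _ => sq_nonneg _) _)
    (summable_of_support_subset hf fun y hy => by simp [hy])

lemma sqMass_univ {Y : Type*} (f : Y → ℝ) : sqMass f Set.univ = sqSum f := by
  simp [sqMass, sqSum]

lemma sqMass_union {Y : Type*} {f : Y → ℝ} (hf : f.support.Finite) {s t : Set Y}
    (h : Disjoint s t) : sqMass f (s ∪ t) = sqMass f s + sqMass f t := by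
  simp only [sqMass]
  rw [← (summable_sqMass hf s).tsum_add (summable_sqMass hf t), Set.indicator_union_of_disjoint h]

lemma sqMass_preimage_smul (f : Y → ℝ) (g : G) (s : Set Y) :
    sqMass f ((fun y => g • y) ⁻¹' s) = sqMass (fun y => f (g⁻¹ • y)) s := by
  unfold sqMass
  rw [← (MulAction.toPerm g).tsum_eq (s.indicator fun y => f (g⁻¹ • y) ^ 2)]
  refine tsum_congr fun y => ?_
  simp only [Set.indicator, MulAction.toPerm_apply, inv_smul_smul]
  rfl

/-- Weighted AM–GM in place of Cauchy–Schwarz: p² - q² = (p - q)(p + q) ≤ (p - q)²/(2η) + η(p² +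
q²). Summed up, the terms give η and 2η times the norm. -/
lemma sqMass_preimage_sub_le {f : Y → ℝ} (hf : f.support.Finite) {g h : G} {η : ℝ} (hη : 0 < η)
    (hgh : sqSum (fun y => f (g⁻¹ • y) - f (h⁻¹ • y)) ≤ 2 * η ^ 2 * sqSum f) (s : Set Y) :
    sqMass f ((fun y => g • y) ⁻¹' s) - sqMass f ((fun y => h • y) ⁻¹' s) ≤
      3 * η * sqSum f := by
  have hs : ∀ k : G, Summable fun y => f (k • y) ^ 2 := fun k =>
    summable_of_support_subset (finite_support_smul hf k) fun y hy => by simp [hy]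
  rw [sqMass_preimage_smul, sqMass_preimage_smul]
  unfold sqMass
  rw [← (summable_sqMass (finite_support_smul hf g⁻¹) s).tsum_sub
    (summable_sqMass (finite_support_smul hf h⁻¹) s)]
  have hsum : Summable fun y => (f (g⁻¹ • y) - f (h⁻¹ • y)) ^ 2 * (1 / (2 * η)) +
      η * (f (g⁻¹ • y) ^ 2 + f (h⁻¹ • y) ^ 2) :=
    ((summable_sub_sq hf _ _).mul_right _).add (((hs _).add (hs _)).mul_left _)
  calc _ ≤ ∑' y, ((f (g⁻¹ • y) - f (h⁻¹ • y)) ^ 2 * (1 / (2 * η)) +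
        η * (f (g⁻¹ • y) ^ 2 + f (h⁻¹ • y) ^ 2)) := by
        refine ((summable_sqMass (finite_support_smul hf g⁻¹) s).sub
          (summable_sqMass (finite_support_smul hf h⁻¹) s)).tsum_le_tsum (fun y => ?_) hsum
        by_cases hy : y ∈ s
        · simp only [Set.indicator_of_mem hy]
          generalize f (g⁻¹ • y) = p
          generalize f (h⁻¹ • y) = q
          have hid : (p - q) ^ 2 * (1 / (2 * η)) + η * (p ^ 2 + q ^ 2) - (p ^ 2 - q ^ 2) =
              η / 2 * ((p - q) / η - (p + q)) ^ 2 + η / 2 * (p - q) ^ 2 := by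
            field_simp
            ring
          have : 0 ≤ η / 2 * ((p - q) / η - (p + q)) ^ 2 + η / 2 * (p - q) ^ 2 := by positivity
          linarith
        · simp only [Set.indicator_of_notMem hy, sub_zero]
          positivity
    _ = sqSum (fun y => f (g⁻¹ • y) - f (h⁻¹ • y)) * (1 / (2 * η)) +
        η * (sqSum f + sqSum f) := by
        rw [((summable_sub_sq hf _ _).mul_right _).tsum_add (((hs _).add (hs _)).mul_left _),
          tsum_mul_right, tsum_mul_left, (hs _).tsum_add (hs _)]
        have : ∀ k : G, ∑' y, f (k • y) ^ 2 = sqSum f := fun k => sqSum_smul f _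
        rw [this, this]
        rfl
    _ ≤ 2 * η ^ 2 * sqSum f * (1 / (2 * η)) + η * (sqSum f + sqSum f) := by gcongr
    _ = 3 * η * sqSum f := by field_simp; ring

/-- Without an invariant mean, averaging is a strict contraction. -/
lemma exists_sqSum_average_le [Nonempty X] {a : X → G}
    (hinv : ∀ x, ∃ x', a x' = (a x)⁻¹)
    (hgen : ∀ g : G, ∃ w : List X, (w.map a).prod = g) (hY : ¬ HasInvariantMean G Y) :
    ∃ ρ : ℝ, 0 ≤ ρ ∧ ρ < 1 ∧
      ∀ f : Y → ℝ, f.support.Finite → sqSum (average a f) ≤ ρ ^ 2 * sqSum f := by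
  by_contra! hcon
  refine hY ?_
  have hd : (0 : ℝ) < Fintype.card X := by exact_mod_cast Fintype.card_pos
  have key : ∀ n : ℕ, ∃ f : Y → ℝ, f.support.Finite ∧ 0 < sqSum f ∧
      ∀ x x' s, sqMass f ((fun y => a x • y) ⁻¹' s) - sqMass f ((fun y => a x' • y) ⁻¹' s) ≤
        3 * (1 / ((n : ℝ) + 1)) * sqSum f := by
    intro n
    set η : ℝ := 1 / ((n : ℝ) + 1) with hη
    have hηpos : 0 < η := by positivity
    -- Chosen so that a relative loss of norm below `ε` puts any two translates within the `2 * η ^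
    -- 2` of `sqMass_preimage_sub_le`.
    set ε : ℝ := η ^ 2 / (Fintype.card X : ℝ) ^ 2 with hε
    have hεpos : 0 < ε := by positivity
    have hρ : Real.sqrt (max (1 - ε) 0) < 1 := by
      rw [Real.sqrt_lt' one_pos]
      simp [hεpos]
    obtain ⟨f, hf, hlt⟩ := hcon _ (Real.sqrt_nonneg _) hρ
    rw [Real.sq_sqrt (le_max_right _ _)] at hlt
    have hlt' : (1 - ε) * sqSum f < sqSum (average a f) :=
      (mul_le_mul_of_nonneg_right (le_max_left _ _) (sqSum_nonneg f)).trans_lt hlt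
    have hid := sum_sum_sqSum_sub hf a
    have hle : ∀ x x', sqSum (fun y => f ((a x)⁻¹ • y) - f ((a x')⁻¹ • y)) ≤
        2 * (Fintype.card X : ℝ) ^ 2 * (sqSum f - sqSum (average a f)) := by
      intro x x'
      rw [← hid]
      exact (Finset.single_le_sum
        (f := fun x' => sqSum (fun y => f ((a x)⁻¹ • y) - f ((a x')⁻¹ • y))) (fun x' _ => sqSum_nonneg _) (Finset.mem_univ x')).trans
        (Finset.single_le_sum
          (f := fun x => ∑ x', sqSum (fun y => f ((a x)⁻¹ • y) - f ((a x')⁻¹ • y)))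
          (fun x _ => Finset.sum_nonneg fun x' _ => sqSum_nonneg _) (Finset.mem_univ x))
    have hpos : 0 < sqSum f := by
      obtain ⟨x⟩ := ‹Nonempty X›
      have h := (sqSum_nonneg _).trans (hle x x)
      have h' : 0 ≤ sqSum f - sqSum (average a f) :=
        nonneg_of_mul_nonneg_right h (by positivity)
      nlinarith
    refine ⟨f, hf, hpos, fun x x' s => sqMass_preimage_sub_le hf hηpos ((hle x x').trans ?_) s⟩
    have hεd : ε * (Fintype.card X : ℝ) ^ 2 = η ^ 2 := by rw [hε]; field_simp
    calc 2 * (Fintype.card X : ℝ) ^ 2 * (sqSum f - sqSum (average a f))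
        ≤ 2 * (Fintype.card X : ℝ) ^ 2 * (ε * sqSum f) := by gcongr; linarith
      _ = 2 * η ^ 2 * sqSum f := by rw [← hεd]; ring
  choose f hfin hpos hinvar using key
  set μ : ℕ → Set Y → ℝ := fun n s => sqMass (f n) s / sqSum (f n) with hμ
  -- The almost invariant densities converge along an ultrafilter by compactness; the limit keeps
  -- finite additivity and becomes exactly insensitive to the choice of letter.
  have hlim : ∀ s, ∃ l ∈ Set.Icc (0 : ℝ) 1, Tendsto (fun n => μ n s) (hyperfilter ℕ) (𝓝 l) := by
    intro s
    refine isCompact_Icc.ultrafilter_le_nhds ((hyperfilter ℕ).map fun n => μ n s) ?_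
    rw [le_principal_iff]
    exact Filter.mem_map.2 <| Filter.univ_mem' fun n => ⟨div_nonneg (sqMass_nonneg _ _) (hpos n).le,
      (div_le_one (hpos n)).2 (sqMass_le_sqSum (hfin n) s)⟩
  choose m hm hmlim using hlim
  have hle : ∀ x x' s, m ((fun y => a x • y) ⁻¹' s) ≤ m ((fun y => a x' • y) ⁻¹' s) := by
    intro x x' s
    have hη : Tendsto (fun n : ℕ => 3 * (1 / ((n : ℝ) + 1))) (hyperfilter ℕ) (𝓝 (3 * 0)) :=
      (tendsto_one_div_add_atTop_nhds_zero_nat.const_mul 3).mono_left Nat.hyperfilter_le_atTop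
    have := le_of_tendsto_of_tendsto' ((hmlim _).sub (hmlim _)) hη fun n => by
      simp only [hμ]
      rw [← sub_div, div_le_iff₀ (hpos n)]
      exact hinvar n x x' s
    linarith
  refine hasInvariantMean_of_letters hinv hgen (m := m) (fun s => (hm s).1) ?_ (fun s t hst => ?_)
    fun x x' s => le_antisymm (hle x x' s) (hle x' x s)
  · refine tendsto_nhds_unique (hmlim _) (tendsto_const_nhds.congr fun n => ?_)
    simp only [hμ, sqMass_univ, div_self (hpos n).ne']
  · refine tendsto_nhds_unique (hmlim _) (((hmlim s).add (hmlim t)).congr fun n => ?_)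
    simp only [hμ]
    rw [sqMass_union (hfin n) hst, add_div]

/-- Without an invariant mean, the distribution of a symmetric random walk decays
exponentially. -/
lemma exists_average_iterate_le [Nonempty X] {a : X → G}
    (hinv : ∀ x, ∃ x', a x' = (a x)⁻¹)
    (hgen : ∀ g : G, ∃ w : List X, (w.map a).prod = g) (hY : ¬ HasInvariantMean G Y) :
    ∃ ρ : ℝ, 0 ≤ ρ ∧ ρ < 1 ∧ ∀ f : Y → ℝ, f.support.Finite → ∀ n z,
      (average a)^[n] f z ≤ ρ ^ n * Real.sqrt (sqSum f) := by
  obtain ⟨ρ, h0, h1, hρ⟩ := exists_sqSum_average_le hinv hgen hY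
  refine ⟨ρ, h0, h1, fun f hf n z => ?_⟩
  have hit : ((average a)^[n] f).support.Finite ∧
      sqSum ((average a)^[n] f) ≤ (ρ ^ n) ^ 2 * sqSum f := by
    induction n with
    | zero => simpa using hf
    | succ n ih =>
      rw [Function.iterate_succ_apply']
      refine ⟨finite_support_average ih.1 a, (hρ _ ih.1).trans ?_⟩
      calc ρ ^ 2 * sqSum ((average a)^[n] f) ≤ ρ ^ 2 * ((ρ ^ n) ^ 2 * sqSum f) := by
            gcongr; exact ih.2
        _ = (ρ ^ (n + 1)) ^ 2 * sqSum f := by ring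
  refine le_of_sq_le_sq ?_ (by positivity)
  rw [mul_pow, Real.sq_sqrt (sqSum_nonneg f)]
  exact (sq_le_sqSum hit.1 z).trans hit.2

end Mean

/-! ### Estimates of densities -/

section Density

variable {X : Type} [Fintype X]

open Classical in
/-- The number of words of length `n` outside `S`. -/
noncomputable def exceptionalCount (S : Set (List X)) (n : ℕ) : ℕ :=
  ((wordsOfLength X n).filter (· ∉ S)).card

open Classical in
lemma ncard_words_le (P : List X → Prop) (n : ℕ) :
    {w : List X | P w ∧ w.length ≤ n}.ncard =
      ∑ j ∈ Finset.range (n + 1), ((wordsOfLength X j).filter P).card := by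
  have h : {w : List X | P w ∧ w.length ≤ n} =
      ((Finset.range (n + 1)).biUnion fun j => (wordsOfLength X j).filter P : Finset (List X)) := by
    ext w
    simp [and_comm]
  rw [h, Set.ncard_coe_finset, Finset.card_biUnion]
  intro i _ j _ hij
  refine Finset.disjoint_left.2 fun w hi hj => hij ?_
  simp only [Finset.mem_filter, mem_wordsOfLength] at hi hj
  exact hi.1.symm.trans hj.1

lemma one_sub_density [Nonempty X] (S : Set (List X)) (n : ℕ) :
    1 - density S n = (∑ j ∈ Finset.range (n + 1), (exceptionalCount S j : ℝ)) /
      ∑ j ∈ Finset.range (n + 1), (Fintype.card X : ℝ) ^ j := by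
  classical
  have hall : {w : List X | w.length ≤ n}.ncard =
      ∑ j ∈ Finset.range (n + 1), Fintype.card X ^ j := by
    simpa [card_wordsOfLength] using ncard_words_le (X := X) (fun _ => True) n
  have hsplit : ({w : List X | w ∈ S ∧ w.length ≤ n}.ncard : ℝ) =
      ∑ j ∈ Finset.range (n + 1), (Fintype.card X : ℝ) ^ j -
        ∑ j ∈ Finset.range (n + 1), (exceptionalCount S j : ℝ) := by
    rw [ncard_words_le (· ∈ S) n, eq_sub_iff_add_eq, Nat.cast_sum, ← Finset.sum_add_distrib]
    refine Finset.sum_congr rfl fun j _ => ?_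
    rw [exceptionalCount]
    have := Finset.card_filter_add_card_filter_not (s := wordsOfLength X j) (· ∈ S)
    rw [card_wordsOfLength] at this
    exact_mod_cast this
  have hpos : 0 < ∑ j ∈ Finset.range (n + 1), (Fintype.card X : ℝ) ^ j := by
    have : (0 : ℝ) < Fintype.card X := by exact_mod_cast Fintype.card_pos
    exact Finset.sum_pos (fun j _ => by positivity) ⟨0, by simp⟩
  rw [density, hsplit, hall]
  push_cast
  field_simp
  ring

/-- A Stolz–Cesàro argument: little-o passes to partial sums, as the sums of the powers diverge. -/
lemma isGeneric_of_exceptionalCount_le [Nonempty X] {S : Set (List X)} {β : ℕ → ℝ}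
    (hβ : Tendsto β atTop (𝓝 0))
    (h : ∀ n, (exceptionalCount S n : ℝ) ≤ β n * (Fintype.card X : ℝ) ^ n) : IsGeneric S := by
  have hd : (1 : ℝ) ≤ Fintype.card X := by exact_mod_cast Fintype.card_pos
  have hpow : ∀ n, (0 : ℝ) < (Fintype.card X : ℝ) ^ n := fun n => by positivity
  have hlittle : (fun n => (exceptionalCount S n : ℝ)) =o[atTop]
      fun n => (Fintype.card X : ℝ) ^ n := by
    refine Asymptotics.isLittleO_of_tendsto (fun n hn => absurd hn (hpow n).ne') ?_
    exact squeeze_zero (fun n => by positivity) (fun n => (div_le_iff₀ (hpow n)).2 (h n)) hβ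
  have htop : Tendsto (fun n => ∑ j ∈ Finset.range n, (Fintype.card X : ℝ) ^ j) atTop atTop := by
    refine tendsto_atTop_mono (fun n => ?_) tendsto_natCast_atTop_atTop
    simpa using Finset.card_nsmul_le_sum (Finset.range n) _ (1 : ℝ) fun j _ => one_le_pow₀ hd
  have hlim := (hlittle.sum_range (fun n => (hpow n).le) htop).tendsto_div_nhds_zero
  have hlim' := hlim.comp (tendsto_add_atTop_nat 1)
  have : Tendsto (fun n => 1 - (1 - density S n)) atTop (𝓝 (1 - 0)) := by
    refine Tendsto.const_sub 1 (hlim'.congr fun n => ?_)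
    rw [one_sub_density]
    rfl
  simpa [IsGeneric] using this

lemma isStronglyGeneric_of_exceptionalCount_le {S : Set (List X)} {ρ K : ℝ}
    (hX : 2 ≤ Fintype.card X) (hρ : 0 ≤ ρ) (hρ1 : ρ < 1) (hK : 0 ≤ K)
    (h : ∀ n, (exceptionalCount S n : ℝ) ≤ K * ρ ^ n * (Fintype.card X : ℝ) ^ n) :
    IsStronglyGeneric S := by
  have hne : Nonempty X := Fintype.card_pos_iff.1 (by omega)
  refine ⟨isGeneric_of_exceptionalCount_le (β := fun n => K * ρ ^ n) ?_ h, ?_⟩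
  · simpa using (tendsto_pow_atTop_nhds_zero_of_lt_one hρ hρ1).const_mul K
  set d : ℝ := (Fintype.card X : ℝ) with hd
  have hd2 : 2 ≤ d := by rw [hd]; exact_mod_cast hX
  -- Keeps the ratio `σ * d` of the geometric sum at least `3 / 2`, hence `1 / (σ * d - 1) ≤ 2`;
  -- this is where the alphabet needs two letters.
  set σ : ℝ := max ρ (3 / 4) with hσ
  have hσ34 : 3 / 4 ≤ σ := le_max_right _ _
  have hσ1 : σ < 1 := max_lt hρ1 (by norm_num)
  have hτ : 3 / 2 ≤ σ * d := by nlinarith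
  refine ⟨σ, (K + 1) * (2 * d), by linarith, hσ1, by positivity, fun n _ => ?_⟩
  rw [one_sub_density, div_le_iff₀ (Finset.sum_pos (fun j _ => by positivity) ⟨0, by simp⟩)]
  calc ∑ j ∈ Finset.range (n + 1), (exceptionalCount S j : ℝ)
      ≤ ∑ j ∈ Finset.range (n + 1), (K + 1) * (σ * d) ^ j := by
        refine Finset.sum_le_sum fun j _ => (h j).trans ?_
        rw [mul_pow, ← mul_assoc]
        gcongr
        · linarith
        · exact le_max_left _ _
    _ = (K + 1) * (((σ * d) ^ (n + 1) - 1) / (σ * d - 1)) := by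
        rw [← Finset.mul_sum, geom_sum_eq (by linarith)]
    _ ≤ (K + 1) * (2 * d * σ ^ n * d ^ n) := by
        gcongr
        rw [div_le_iff₀ (by linarith)]
        have hp : 0 ≤ (σ * d) ^ n := by positivity
        have e : 2 * d * σ ^ n * d ^ n = 2 * d * (σ * d) ^ n := by rw [mul_pow]; ring
        rw [e, pow_succ]
        have h1 : (σ * d) ^ n * (σ * d) ≤ (σ * d) ^ n * d := by
          gcongr
          nlinarith
        have h2 : (σ * d) ^ n * d ≤ (σ * d) ^ n * d * (2 * (σ * d - 1)) :=
          le_mul_of_one_le_right (by positivity) (by linarith)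
        linarith
    _ ≤ (K + 1) * (2 * d) * σ ^ n * ∑ j ∈ Finset.range (n + 1), d ^ j := by
        have : d ^ n ≤ ∑ j ∈ Finset.range (n + 1), d ^ j :=
          Finset.single_le_sum (f := fun j => d ^ j) (fun j _ => by positivity) (by simp)
        have hσ0 : 0 ≤ σ := by linarith
        calc (K + 1) * (2 * d * σ ^ n * d ^ n) = (K + 1) * (2 * d) * σ ^ n * d ^ n := by ring
          _ ≤ _ := by gcongr

/-- If the exceptional words take a base point into `A`, then their number is governed by a random
walk. -/
lemma exceptionalCount_le_average {G Y : Type*} [Group G] [MulAction G Y] [Nonempty X]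
    {a : X → G} {S : Set (List X)} {A : Set Y} {z : Y}
    (h : ∀ w ∉ S, (w.map a).prod⁻¹ • z ∈ A) (n : ℕ) :
    (exceptionalCount S n : ℝ) ≤
      (average a)^[n] (A.indicator 1) z * (Fintype.card X : ℝ) ^ n := by
  classical
  have hd : (Fintype.card X : ℝ) ^ n ≠ 0 := by
    have : (0 : ℝ) < Fintype.card X := by exact_mod_cast Fintype.card_pos
    positivity
  rw [average_iterate, div_mul_cancel₀ _ hd, exceptionalCount, Finset.card_filter, Nat.cast_sum]
  refine Finset.sum_le_sum fun w _ => ?_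
  by_cases hw : w ∈ S
  · simpa [hw] using Set.indicator_nonneg (f := (1 : Y → ℝ)) (fun _ _ => zero_le_one) _
  · simp [hw, h w hw]

end Density

/-! ### Schreier rewriting -/

section Rewriting

variable {G : Type*} [Group G]

/-- The element represented by a letter. -/
def letterValue {k : ℕ} (π : Fin k → G) (x : Fin k × Bool) : G :=
  if x.2 then π x.1 else (π x.1)⁻¹

lemma evalWord_eq {k : ℕ} (π : Fin k → G) (w : List (Fin k × Bool)) :
    evalWord π w = (w.map (letterValue π)).prod := rfl

lemma evalWord_cons {k : ℕ} (π : Fin k → G) (x : Fin k × Bool) (w : List (Fin k × Bool)) :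
    evalWord π (x :: w) = letterValue π x * evalWord π w := by
  simp [evalWord_eq]

lemma exists_letterValue_eq_inv {k : ℕ} (π : Fin k → G) (x : Fin k × Bool) :
    ∃ x', letterValue π x' = (letterValue π x)⁻¹ := by
  obtain ⟨i, b⟩ := x
  exact ⟨(i, !b), by cases b <;> simp [letterValue]⟩

lemma evalWord_mem_closure {k : ℕ} (π : Fin k → G) (w : List (Fin k × Bool)) :
    evalWord π w ∈ Subgroup.closure (Set.range π) := by
  induction w with
  | nil => exact one_mem _
  | cons x w ih =>
    rw [evalWord_cons]
    refine mul_mem ?_ ih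
    have hx : π x.1 ∈ Subgroup.closure (Set.range π) := Subgroup.subset_closure ⟨x.1, rfl⟩
    unfold letterValue
    split_ifs
    exacts [hx, inv_mem hx]

lemma Generates.exists_evalWord_eq {k : ℕ} {π : Fin k → G} (h : Generates π) (g : G) :
    ∃ w, evalWord π w = g := by
  have hg : g ∈ Subgroup.closure (Set.range π) := h ▸ Subgroup.mem_top g
  induction hg using Subgroup.closure_induction with
  | mem x hx =>
    obtain ⟨i, rfl⟩ := hx
    exact ⟨[(i, true)], by simp [evalWord]⟩
  | one => exact ⟨[], rfl⟩
  | mul x y _ _ hx hy =>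
    obtain ⟨v, rfl⟩ := hx
    obtain ⟨w, rfl⟩ := hy
    exact ⟨v ++ w, by simp [evalWord]⟩
  | inv x hmem hx =>
    clear hmem
    obtain ⟨w, rfl⟩ := hx
    induction w with
    | nil => exact ⟨[], by simp [evalWord]⟩
    | cons x w ih =>
      obtain ⟨v, hv⟩ := ih
      obtain ⟨x', hx'⟩ := exists_letterValue_eq_inv π x
      refine ⟨v ++ [x'], ?_⟩
      rw [evalWord_cons, mul_inv_rev, ← hv, ← hx']
      simp [evalWord_eq]

variable (H : Subgroup G)

/-- The Schreier cocycle of a subgroup: it moves from the representative of the coset `c` along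
`g` and back to a representative. -/
noncomputable def schreier (c : G ⧸ H) (g : G) : H :=
  ⟨c.out⁻¹ * g * (g⁻¹ • c).out, by
    rw [mul_assoc, ← QuotientGroup.eq, QuotientGroup.out_eq', ← smul_eq_mul,
      ← MulAction.Quotient.smul_mk]
    simp⟩

lemma coe_schreier (c : G ⧸ H) (g : G) :
    (schreier H c g : G) = c.out⁻¹ * g * (g⁻¹ • c).out := rfl

@[simp] lemma schreier_one (c : G ⧸ H) : schreier H c 1 = 1 :=
  Subtype.ext (by simp [coe_schreier])

lemma schreier_mul (c : G ⧸ H) (g h : G) :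
    schreier H c (g * h) = schreier H c g * schreier H (g⁻¹ • c) h :=
  Subtype.ext (by simp [coe_schreier, mul_smul, mul_assoc])

lemma exists_schreier_eq (h : H) : ∃ g, schreier H ((1 : G) : G ⧸ H) g = h := by
  set s : G := ((1 : G) : G ⧸ H).out with hs
  have hsH : s ∈ H := by
    have : ((1 : G) : G ⧸ H) = (s : G ⧸ H) := (QuotientGroup.out_eq' _).symm
    simpa using QuotientGroup.eq.1 this
  -- The chosen representative `s` of the trivial coset need not be 1, hence the conjugation.
  refine ⟨s * h * s⁻¹, Subtype.ext ?_⟩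
  have hfix : (s * h * s⁻¹)⁻¹ • ((1 : G) : G ⧸ H) = ((1 : G) : G ⧸ H) := by
    rw [MulAction.Quotient.smul_coe, smul_eq_mul, mul_one]
    refine (QuotientGroup.eq.2 ?_).symm
    simpa [mul_assoc] using mul_mem (mul_mem hsH (inv_mem h.2)) (inv_mem hsH)
  rw [coe_schreier, hfix, ← hs]
  group

variable {H}

/-- Reidemeister–Schreier rewriting into a quotient of a subgroup of finite index is done by a
reversible automaton. -/
lemma exists_transduce_eq_schreier [H.FiniteIndex] {Q : Type*} [Group Q] {φ : H →* Q}
    (hφ : Function.Surjective φ) {k : ℕ} {π : Fin k → G} (hπ : Generates π) :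
    ∃ (m l : ℕ) (step : Fin k × Bool → Equiv.Perm (Fin m))
      (out : Fin m → Fin k × Bool → Fin l × Bool) (r₀ : Fin m) (τ : Fin l → Q),
      Generates τ ∧ ∀ w, evalWord τ (transduce step out r₀ w) =
        φ (schreier H ((1 : G) : G ⧸ H) (evalWord π w)) := by
  -- Numbering brings states and letters into `Type`, as machines demand. There is one new generator
  -- for each pair of a coset and a letter, so only positive letters are written.
  let e := Finite.equivFin (G ⧸ H)
  let e' := Finite.equivFin (Fin (Nat.card (G ⧸ H)) × (Fin k × Bool))
  let step : Fin k × Bool → Equiv.Perm (Fin (Nat.card (G ⧸ H))) := fun x =>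
    (e.symm.trans (MulAction.toPerm (letterValue π x)⁻¹)).trans e
  let out : Fin (Nat.card (G ⧸ H)) → Fin k × Bool → Fin _ × Bool := fun r x => (e' (r, x), true)
  let τ : Fin _ → Q := fun i =>
    φ (schreier H (e.symm (e'.symm i).1) (letterValue π (e'.symm i).2))
  have key : ∀ w r, evalWord τ (transduce step out r w) =
      φ (schreier H (e.symm r) (evalWord π w)) := by
    intro w
    induction w with
    | nil => intro r; simp [transduce, evalWord]
    | cons x w ih =>
      intro r
      rw [transduce, evalWord_cons, ih, evalWord_cons, schreier_mul, map_mul]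
      simp [out, τ, step, letterValue]
  have key' : ∀ w, evalWord τ (transduce step out (e ((1 : G) : G ⧸ H)) w) =
      φ (schreier H ((1 : G) : G ⧸ H) (evalWord π w)) := fun w => by simp [key]
  refine ⟨_, _, step, out, e ((1 : G) : G ⧸ H), τ, eq_top_iff.2 fun q _ => ?_, key'⟩
  obtain ⟨h, rfl⟩ := hφ q
  obtain ⟨g, rfl⟩ := exists_schreier_eq H h
  obtain ⟨w, rfl⟩ := hπ.exists_evalWord_eq g
  exact key' w ▸ evalWord_mem_closure τ _

end Rewriting

/-! ### The action on the cosets of the kernel -/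

section Kernel

variable {G Q : Type*} [Group G] [Group Q] {H : Subgroup G} (φ : H →* Q)

/-- The kernel of a homomorphism defined on a subgroup, as a subgroup of the whole group. -/
def kernelIn : Subgroup G := φ.ker.map H.subtype

variable {φ}

lemma coe_mem_kernelIn {h : H} : (h : G) ∈ kernelIn φ ↔ φ h = 1 := by
  simp [kernelIn]

lemma mk_eq_mk_iff {h h' : H} :
    ((h : G) : G ⧸ kernelIn φ) = ((h' : G) : G ⧸ kernelIn φ) ↔ φ h = φ h' := by
  rw [QuotientGroup.eq]
  have : (h : G)⁻¹ * (h' : G) = ((h⁻¹ * h' : H) : G) := by simp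
  rw [this, coe_mem_kernelIn, map_mul, map_inv, inv_mul_eq_one]

lemma infinite_quotient_kernelIn [Infinite Q] (hφ : Function.Surjective φ) :
    Infinite (G ⧸ kernelIn φ) := by
  refine Infinite.of_injective
    (fun q => (((Function.surjInv hφ q : H) : G) : G ⧸ kernelIn φ)) fun q q' h => ?_
  simpa [Function.surjInv_eq] using mk_eq_mk_iff.1 h

/-- An invariant mean on the cosets of the kernel restricts to one on the quotient. -/
lemma isAmenable_of_hasInvariantMean [H.FiniteIndex] (hφ : Function.Surjective φ)
    (h : HasInvariantMean G (G ⧸ kernelIn φ)) : IsAmenable Q := by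
  obtain ⟨m, h0, h1, hadd, hinv⟩ := h
  have hmono : ∀ s t, s ⊆ t → m s ≤ m t := by
    intro s t hst
    rw [← Set.union_sdiff_cancel hst, hadd _ _ Set.disjoint_sdiff_right]
    linarith [h0 (t \ s)]
  have hunion : ∀ s t, m (s ∪ t) ≤ m s + m t := by
    intro s t
    rw [← Set.union_sdiff_self, hadd _ _ Set.disjoint_sdiff_right]
    linarith [hmono (t \ s) t Set.sdiff_subset]
  let ι : Set Q → Set (G ⧸ kernelIn φ) := fun s =>
    (fun h : H => ((h : G) : G ⧸ kernelIn φ)) '' (φ ⁻¹' s)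
  -- Finitely many translates of this set, one per coset of `H`, cover the space; if it were null,
  -- so would be everything. Its mass then serves as normalisation.
  have hpos : 0 < m (ι Set.univ) := by
    refine lt_of_le_of_ne (h0 _) fun hzero => ?_
    have hnull : ∀ T : Finset (G ⧸ H),
        m (⋃ c ∈ T, (fun y => c.out⁻¹ • y) ⁻¹' ι Set.univ) ≤ 0 := by
      classical
      intro T
      induction T using Finset.induction_on with
      | empty =>
        have := hadd ∅ ∅ (by simp)
        simp only [Set.union_self] at this
        simp
        linarith
      | insert c T _ ih =>
        rw [Finset.set_biUnion_insert]
        refine (hunion _ _).trans ?_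
        rw [hinv, ← hzero]
        simpa using ih
    have : Fintype (G ⧸ H) := Fintype.ofFinite _
    have hcover : (⋃ c ∈ (Finset.univ : Finset (G ⧸ H)),
        (fun y => c.out⁻¹ • y) ⁻¹' ι Set.univ) = Set.univ := by
      refine Set.eq_univ_of_forall fun y => ?_
      obtain ⟨g, rfl⟩ := QuotientGroup.mk_surjective y
      simp only [Set.mem_iUnion]
      have hg : ((g : G) : G ⧸ H).out⁻¹ * g ∈ H :=
        QuotientGroup.eq.1 (QuotientGroup.out_eq' _)
      exact ⟨(g : G ⧸ H), Finset.mem_univ _, ⟨_, hg⟩, trivial, rfl⟩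
    have := hnull Finset.univ
    rw [hcover, h1] at this
    linarith
  refine ⟨fun s => m (ι s) / m (ι Set.univ), fun s => div_nonneg (h0 _) (h0 _),
    div_self hpos.ne', fun s t hst => ?_, fun q s => ?_⟩
  · simp only
    rw [← add_div, ← hadd]
    · simp only [ι, Set.preimage_union, Set.image_union]
    · rw [Set.disjoint_left]
      rintro _ ⟨g, hg, rfl⟩ ⟨g', hg', he⟩
      have := mk_eq_mk_iff.1 he
      exact Set.disjoint_left.1 hst hg (this ▸ hg')
  · obtain ⟨k, rfl⟩ := hφ q
    simp only
    rw [← hinv (k : G)⁻¹ (ι s)]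
    congr 2
    ext y
    constructor
    · rintro ⟨g, ⟨q, hq, hg⟩, rfl⟩
      refine ⟨k⁻¹ * g, ?_, ?_⟩
      · simpa [← hg] using hq
      · simp
    · rintro ⟨g, hg, he⟩
      refine ⟨k * g, ⟨φ g, hg, by simp⟩, ?_⟩
      have : (k : G) • (((g : H) : G) : G ⧸ kernelIn φ) = y := by
        simp only at he
        rw [he]
        simp
      simpa using this

end Kernel

/-- The words whose rewriting is nontrivial in an infinite quotient of a subgroup of finite index
form a generic set on which the word problem is solved within the bounds for the quotient. -/
lemma exists_isGeneric_solvesOn {G Q : Type*} [Group G] [Group Q] [Infinite Q] {G₁ : Subgroup G}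
    [G₁.FiniteIndex] {φ : G₁ →* Q} (hφ : Function.Surjective φ) {C : ComplexityClass}
    (hQ : WordProblemIn C Q) {k : ℕ} {π : Fin k → G} (hπ : Generates π) :
    ∃ S : Set (List (Fin k × Bool)),
      C.SolvesOn (wordProblem π) S ∧ IsGeneric S ∧ (¬ IsAmenable Q → IsStronglyGeneric S) := by
  obtain ⟨m, l, step, out, r₀, τ, hτ, hrew⟩ := exists_transduce_eq_schreier hφ hπ
  have hY : Infinite (G ⧸ kernelIn φ) := infinite_quotient_kernelIn hφ
  have hinv := exists_letterValue_eq_inv π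
  have hgen : ∀ g : G, ∃ w : List (Fin k × Bool), (w.map (letterValue π)).prod = g :=
    hπ.exists_evalWord_eq
  -- An empty alphabet generates only the trivial group, which has no infinite coset space.
  have hX : Nonempty (Fin k × Bool) := by
    by_contra hE
    rw [not_nonempty_iff] at hE
    have : Subsingleton G := ⟨fun g h => by
      obtain ⟨v, rfl⟩ := hgen g
      obtain ⟨w, rfl⟩ := hgen h
      rw [Subsingleton.elim v w]⟩
    exact not_finite (G ⧸ kernelIn φ)
  have hX2 : 2 ≤ Fintype.card (Fin k × Bool) := by
    have := hX.some.1.pos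
    simp only [Fintype.card_prod, Fintype.card_fin, Fintype.card_bool]
    omega
  set S : Set (List (Fin k × Bool)) := {w | transduce step out r₀ w ∉ wordProblem τ} with hS
  set A : Set (G ⧸ kernelIn φ) := Set.range fun c : G ⧸ G₁ => (c.out : G ⧸ kernelIn φ) with hA
  have hAfin : A.Finite := Set.finite_range _
  set z : G ⧸ kernelIn φ := (((1 : G) : G ⧸ G₁).out : G ⧸ kernelIn φ) with hz
  -- With `g` the value of `w`, and `s`, `s'` the representatives of the trivial coset and of its
  -- image under `g⁻¹`, trivial rewriting means that `s⁻¹ * g * s'` lies in the kernel, so that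
  -- `g⁻¹` takes the class of `s` to that of `s'`.
  have hexc : ∀ w ∉ S, (w.map (letterValue π)).prod⁻¹ • z ∈ A := by
    intro w hw
    have hone : φ (schreier G₁ ((1 : G) : G ⧸ G₁) (evalWord π w)) = 1 := by
      rw [← hrew]
      exact not_not.1 hw
    rw [← coe_mem_kernelIn, coe_schreier] at hone
    refine ⟨(evalWord π w)⁻¹ • ((1 : G) : G ⧸ G₁), ?_⟩
    rw [hz, ← evalWord_eq, MulAction.Quotient.smul_coe, smul_eq_mul]
    refine (QuotientGroup.eq.2 ?_).symm
    simpa [mul_assoc] using hone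
  have hcount := exceptionalCount_le_average hexc
  refine ⟨S, ?_, ?_, fun hQna => ?_⟩
  · refine (hQ l τ hτ).solvesOn_transduce step out r₀ fun w hw => ?_
    change evalWord τ _ = 1
    rw [hrew, show evalWord π w = 1 from hw]
    simp
  · refine isGeneric_of_exceptionalCount_le ?_ hcount
    refine tendsto_average_iterate hinv hgen (B := hAfin.toFinset.card)
      (fun y => Set.indicator_nonneg (fun _ _ => zero_le_one) y) (fun T => ?_) z
    classical
    calc ∑ y ∈ T, A.indicator (1 : G ⧸ kernelIn φ → ℝ) y
        = ((T.filter (· ∈ A)).card : ℝ) := by simp [Set.indicator_apply]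
      _ ≤ hAfin.toFinset.card := by
        gcongr
        intro y hy
        simpa using (Finset.mem_filter.1 hy).2
  · have hmean : ¬ HasInvariantMean G (G ⧸ kernelIn φ) :=
      fun h => hQna (isAmenable_of_hasInvariantMean hφ h)
    obtain ⟨ρ, hρ0, hρ1, hρ⟩ := exists_average_iterate_le hinv hgen hmean
    refine isStronglyGeneric_of_exceptionalCount_le hX2 hρ0 hρ1
      (Real.sqrt_nonneg (sqSum (A.indicator (1 : G ⧸ kernelIn φ → ℝ))))
      fun n => (hcount n).trans ?_
    rw [mul_comm (Real.sqrt _)]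
    gcongr
    exact hρ _ (hAfin.subset fun y hy => by_contra fun h => hy (by simp [h])) n z

end GenericComplexity

theorem theoremA {G : Type*} [Group G] [Group.FG G]
    (G₁ : Subgroup G) [G₁.FiniteIndex]
    {Q : Type*} [Group Q] [Infinite Q] (φ : G₁ →* Q) (hφ : Function.Surjective φ)
    (C : GenericComplexity.ComplexityClass) (hQ : GenericComplexity.WordProblemIn C Q) :
    GenericComplexity.WordProblemGenericallyIn C G ∧
      (¬ GenericComplexity.IsAmenable Q →
        GenericComplexity.WordProblemStronglyGenericallyIn C G) := by
  exact ⟨fun k π hπ => (GenericComplexity.exists_isGeneric_solvesOn hφ hQ hπ).imp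
      fun S h => ⟨h.2.1, h.1⟩,
    fun hna k π hπ => (GenericComplexity.exists_isGeneric_solvesOn hφ hQ hπ).imp
      fun S h => ⟨h.2.2 hna, h.1⟩⟩
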